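/- Let $\mathbb K=\mathbb R$ or $\mathbb C$. For a nilpotent Lie algebra $\mathfrak g$ over $\mathbb K$ and $X\in\mathfrak g$, let $c(X)$ be the decreasing sequence of the sizes of the Jordan blocks of the nilpotent operator $\operatorname{ad}X$; the characteristic sequence of $\mathfrak g$ is $c(\mathfrak g)=\max\{c(X): X\in\mathfrak g\setminus[\mathfrak g,\mathfrak g]\}$ for the lexicographic order. A symplectic form on $\mathfrak g$ is a nondegenerate alternating bilinear form $\theta$ on $\mathfrak g$ with $\theta([X,Y],Z)+\theta([Y,Z],X)+\theta([Z,X],Y)=0$ for all $X,Y,Z\in\mathfrak g$, and $\mathfrak g$ is called symplectic if it admits such a form. For $\alpha\in\mathfrak g^*$ put $d\alpha(X,Y)=-\alpha([X,Y])$. **Theorem.** Let $\mathfrak g$ be an $8$-dimensional $2$-step nilpotent Lie algebra over $\mathbb K$ (that is, $[\mathfrak g,\mathfrak g]\neq 0$ and $[\mathfrak g,[\mathfrak g,\mathfrak g]]=0$) whose characteristic sequence is $(2,2,2,1,1)$. Then $\mathfrak g$ is symplectic if and only if it is not isomorphic to the $8$-dimensional Lie algebra over $\mathbb K$ whose Maurer–Cartan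 equations, in the basis $\alpha_1,\dots,\alpha_8$ dual to some basis of the algebra, are $$d\alpha_3=-\alpha_1\wedge\alpha_2,\qquad d\alpha_5=-\alpha_1\wedge\alpha_4,\qquad d\alpha_7=-\alpha_1\wedge\alpha_6-\alpha_2\wedge\alpha_4-\alpha_6\wedge\alpha_8,$$ $$d\alpha_i=0\quad (i=1,2,4,6,8).$$ -/

import Mathlib

/-- `LieAlgebra.IsStepNilpotent K L k`: the nilindex of `L` is `k`, that is, `k` is the smallest
index at which the lower central series `C⁰(L) = L`, `Cʲ(L) = [L, Cʲ⁻¹(L)]` vanishes. -/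
def LieAlgebra.IsStepNilpotent (K L : Type*) [CommRing K] [LieRing L] [LieAlgebra K L]
    (k : ℕ) : Prop :=
  LieModule.lowerCentralSeries K L L k = ⊥ ∧
    ∀ j < k, LieModule.lowerCentralSeries K L L j ≠ ⊥

/-- `T` is nilpotent and `l` is the decreasing list of the sizes of its Jordan blocks: there is a
basis made of chains `b i 0 ↦ b i 1 ↦ ⋯ ↦ b i (lᵢ - 1) ↦ 0`, the `i`-th of length `lᵢ`. -/
def LinearMap.HasNilpotentJordanType {K V : Type*} [Field K] [AddCommGroup V] [Module K V]
    (T : V →ₗ[K] V) (l : List ℕ) : Prop :=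
  l.SortedGE ∧ (∀ n ∈ l, 0 < n) ∧
    ∃ b : Module.Basis (Σ i : Fin l.length, Fin (l.get i)) K V,
      ∀ (i : Fin l.length) (j : Fin (l.get i)),
        T (b ⟨i, j⟩) = if h : (j : ℕ) + 1 < l.get i then b ⟨i, ⟨(j : ℕ) + 1, h⟩⟩ else 0

/-- `c` is the characteristic sequence of the nilpotent Lie algebra `L`: the maximum, for the
lexicographic order, of the Jordan block sizes of `ad X` over all `X ∈ L` outside `[L, L]`. -/
def LieAlgebra.IsCharacteristicSequence (K L : Type*) [Field K] [LieRing L] [LieAlgebra K L]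
    (c : List ℕ) : Prop :=
  IsGreatest {l : List ℕ | ∃ X : L, X ∉ LieModule.lowerCentralSeries K L L 1 ∧
    (LieAlgebra.ad K L X).HasNilpotentJordanType l} c

/-- A symplectic form on a Lie algebra: an alternating, closed, nondegenerate bilinear form. -/
structure LieAlgebra.IsSymplecticForm {K L : Type*} [Field K] [LieRing L] [LieAlgebra K L]
    (θ : LinearMap.BilinForm K L) : Prop where
  alt : θ.IsAlt
  closed : ∀ X Y Z : L, θ ⁅X, Y⁆ Z + θ ⁅Y, Z⁆ X + θ ⁅Z, X⁆ Y = 0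
  nondegenerate : θ.Nondegenerate

/-- A Lie algebra is symplectic if it admits a symplectic form. -/
def LieAlgebra.IsSymplectic (K L : Type*) [Field K] [LieRing L] [LieAlgebra K L] : Prop :=
  ∃ θ : LinearMap.BilinForm K L, LieAlgebra.IsSymplecticForm θ

/-- The vector space `K⁸`, which carries the Lie bracket with Maurer-Cartan equations
`dα₃ = -α₁∧α₂`, `dα₅ = -α₁∧α₄`, `dα₇ = -α₁∧α₆ - α₂∧α₄ - α₆∧α₈`, and `dαᵢ = 0` otherwise.
The form `αᵢ` is the coordinate of index `i - 1`. -/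
def ExceptionalAlgebra (K : Type*) : Type _ := Fin 8 → K

namespace ExceptionalAlgebra

instance (K : Type*) [Field K] : AddCommGroup (ExceptionalAlgebra K) :=
  inferInstanceAs (AddCommGroup (Fin 8 → K))

instance (K : Type*) [Field K] : Module K (ExceptionalAlgebra K) :=
  inferInstanceAs (Module K (Fin 8 → K))

/-- The linear forms `α₁, …, α₈` of the dual basis. -/
def coord (K : Type*) [Field K] (i : ℕ) (hi : 1 ≤ i ∧ i ≤ 8 := by decide) :
    Module.Dual K (ExceptionalAlgebra K) :=
  LinearMap.proj (R := K) (φ := fun _ : Fin 8 => K) ⟨i - 1, by omega⟩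

/-- The bracket is determined by `α [x, y] = -dα (x, y)`. -/
instance (K : Type*) [Field K] : Bracket (ExceptionalAlgebra K) (ExceptionalAlgebra K) where
  bracket x y :=
    ![0, 0,
      x 0 * y 1 - x 1 * y 0,
      0,
      x 0 * y 3 - x 3 * y 0,
      0,
      (x 0 * y 5 - x 5 * y 0) + (x 1 * y 3 - x 3 * y 1) + (x 5 * y 7 - x 7 * y 5),
      0]

theorem bracket_apply {K : Type*} [Field K] (x y : ExceptionalAlgebra K) (i : Fin 8) :
    ⁅x, y⁆ i = (![0, 0,
      x 0 * y 1 - x 1 * y 0,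
      0,
      x 0 * y 3 - x 3 * y 0,
      0,
      (x 0 * y 5 - x 5 * y 0) + (x 1 * y 3 - x 3 * y 1) + (x 5 * y 7 - x 7 * y 5),
      0] : Fin 8 → K) i := rfl

theorem add_apply {K : Type*} [Field K] (x y : ExceptionalAlgebra K) (i : Fin 8) :
    (x + y) i = x i + y i := rfl

theorem smul_apply {K : Type*} [Field K] (c : K) (x : ExceptionalAlgebra K) (i : Fin 8) :
    (c • x) i = c * x i := rfl

theorem zero_apply {K : Type*} [Field K] (i : Fin 8) :
    (0 : ExceptionalAlgebra K) i = 0 := rfl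

instance (K : Type*) [Field K] : LieRing (ExceptionalAlgebra K) where
  add_lie x y z := by
    funext i
    fin_cases i <;> simp [bracket_apply, add_apply] <;> ring
  lie_add x y z := by
    funext i
    fin_cases i <;> simp [bracket_apply, add_apply] <;> ring
  lie_self x := by
    funext i
    fin_cases i <;> simp [bracket_apply, zero_apply] <;> ring
  leibniz_lie x y z := by
    funext i
    fin_cases i <;> simp [bracket_apply, add_apply]

instance (K : Type*) [Field K] : LieAlgebra K (ExceptionalAlgebra K) where
  lie_smul c x y := by
    funext i
    fin_cases i <;> simp [bracket_apply, smul_apply] <;> ring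

theorem coord_apply {K : Type*} [Field K] (i : ℕ) (hi : 1 ≤ i ∧ i ≤ 8)
    (x : ExceptionalAlgebra K) : coord K i hi x = x ⟨i - 1, by omega⟩ := rfl

/-- The Maurer-Cartan equations, with `dα (x, y) = -α [x, y]` and
`(α ∧ β) (x, y) = α x * β y - α y * β x`. -/
theorem maurerCartan {K : Type*} [Field K] (x y : ExceptionalAlgebra K) :
    let d (α : Module.Dual K (ExceptionalAlgebra K)) : K := -α ⁅x, y⁆
    let w (α β : Module.Dual K (ExceptionalAlgebra K)) : K := α x * β y - α y * β x
    d (coord K 3) = -w (coord K 1) (coord K 2) ∧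
    d (coord K 5) = -w (coord K 1) (coord K 4) ∧
    d (coord K 7) = -w (coord K 1) (coord K 6) - w (coord K 2) (coord K 4)
      - w (coord K 6) (coord K 8) ∧
    d (coord K 1) = 0 ∧ d (coord K 2) = 0 ∧ d (coord K 4) = 0 ∧ d (coord K 6) = 0 ∧
    d (coord K 8) = 0 := by
  refine ⟨?_, ?_, ?_, ?_, ?_, ?_, ?_, ?_⟩ <;> simp [coord_apply, bracket_apply] <;> ring

end ExceptionalAlgebra

/-! The characteristic sequence supplies `x` with `ad x` of rank 3, hence three independent brackets
`⁅x, vᵢ⁆`, spanning a subspace `S`. A symplectic form is sought as `∑ ξᵢ ∧ ηᵢ` with closed `ηᵢ`,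
where all the `ξᵢ` but possibly one are coordinates on brackets; closedness is then a system of
linear equations in the coefficients of the `ηᵢ`.

If some bracket lies outside `S`, it completes `x`, `vᵢ`, `⁅x, vᵢ⁆` to a basis, and the system is
always solvable (`isSymplectic_of_four`).

Otherwise the derived algebra is `S`, and some `w` outside `K x + S` commutes with `x`. The bracket
is encoded by two 3×3 matrices: `P`, for the brackets of the `vᵢ`, and `Q`, the endomorphism of `S`
sending `⁅x, vᵢ⁆` to `⁅vᵢ, w⁆`. Replacing `w` by `w + r x` subtracts `r` from `Q`, so by
`exists_normalForm` one may take `Q` cyclic, zero, or of rank one, either diagonal or nilpotent. An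
invertible symmetric `S` with `tr (P S) = 0` and `S Q` symmetric gives a symplectic form. In the
cyclic and nilpotent cases, when no such matrix is at hand, adding components along `e` and `f` to
the closed factors restores solvability. In the diagonal case the only obstruction is that `P 0 0 ≠
0` while the lower 2×2 block of `P` is antisymmetric; a change of coframe then gives exactly the
exceptional algebra (`nonempty_equiv_exceptionalAlgebra`).

The exceptional algebra is not symplectic because a nonzero central vector lies in the radical of
every closed form. -/

namespace LieAlgebra

open Module

/-! ### Symplectic forms as sums of exterior products. -/

/-- The exterior product of two linear forms, as a function of two vectors. -/
def wedge {K V : Type*} [Field K] [AddCommGroup V] [Module K V] (α β : Dual K V) (x y : V) : K :=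
  α x * β y - α y * β x

/-- The alternating bilinear form `∑ ξᵢ ∧ ηᵢ`. -/
def wedgeSum {K V : Type*} [Field K] [AddCommGroup V] [Module K V] {n : ℕ}
    (ξ η : Fin n → Dual K V) : LinearMap.BilinForm K V :=
  ∑ i, ((ξ i).smulRight (η i) - (η i).smulRight (ξ i))

theorem wedgeSum_apply {K V : Type*} [Field K] [AddCommGroup V] [Module K V] {n : ℕ}
    (ξ η : Fin n → Dual K V) (x y : V) :
    wedgeSum ξ η x y = ∑ i, wedge (ξ i) (η i) x y := by
  simp only [wedgeSum, LinearMap.sum_apply, LinearMap.sub_apply, LinearMap.smulRight_apply,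
    LinearMap.smul_apply, smul_eq_mul, wedge]
  exact Finset.sum_congr rfl fun i _ => by ring

theorem wedgeSum_isAlt {K V : Type*} [Field K] [AddCommGroup V] [Module K V] {n : ℕ}
    (ξ η : Fin n → Dual K V) : (wedgeSum ξ η).IsAlt := fun x => by
  simp [wedgeSum_apply, wedge]

/-- If `ξ₁, …, ξₙ, η₁, …, ηₙ` is a basis of the dual space, then `∑ ξᵢ ∧ ηᵢ` is nondegenerate. -/
theorem wedgeSum_nondegenerate {K V : Type*} [Field K] [AddCommGroup V] [Module K V]
    [FiniteDimensional K V] {n : ℕ} (ξ η : Fin n → Dual K V) (hdim : finrank K V = 2 * n)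
    (hinj : ∀ x, (∀ i, ξ i x = 0) → (∀ i, η i x = 0) → x = 0) :
    (wedgeSum ξ η).Nondegenerate := by
  let Ψ : V →ₗ[K] (Fin n → K) × (Fin n → K) := (LinearMap.pi ξ).prod (LinearMap.pi η)
  have hΨ : Function.Injective Ψ := by
    rw [injective_iff_map_eq_zero]
    intro x hx
    have h := Prod.mk.inj hx
    exact hinj x (fun i => congrFun h.1 i) (fun i => congrFun h.2 i)
  have hsurj : Function.Surjective Ψ :=
    (LinearMap.injective_iff_surjective_of_finrank_eq_finrank (by simp [hdim, two_mul])).1 hΨ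
  have hleft : ∀ x, (∀ y, wedgeSum ξ η x y = 0) → x = 0 := by
    intro x hx
    refine hinj x (fun i => ?_) (fun i => ?_)
    -- A vector on which every form of the family vanishes except `η i` isolates the coordinate `ξ i
    -- x`.
    · obtain ⟨y, hy⟩ := hsurj (0, Pi.single i 1)
      have h := Prod.mk.inj hy
      have h1 : ∀ j, ξ j y = 0 := fun j => congrFun h.1 j
      have h2 : ∀ j, η j y = Pi.single (M := fun _ => K) i 1 j := fun j => congrFun h.2 j
      have := hx y
      simpa [wedgeSum_apply, wedge, h1, h2, Pi.single_apply] using this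
    · obtain ⟨y, hy⟩ := hsurj (Pi.single i 1, 0)
      have h := Prod.mk.inj hy
      have h1 : ∀ j, ξ j y = Pi.single (M := fun _ => K) i 1 j := fun j => congrFun h.1 j
      have h2 : ∀ j, η j y = 0 := fun j => congrFun h.2 j
      have := hx y
      simpa [wedgeSum_apply, wedge, h1, h2, Pi.single_apply] using this
  refine ⟨hleft, fun y hy => hleft y fun x => ?_⟩
  rw [← LinearMap.IsAlt.neg (wedgeSum_isAlt ξ η), hy x, neg_zero]

/-- A basis `ξᵢ, ηᵢ` of the dual space such that every `ηᵢ` is closed and `∑ ξᵢ ∧ ηᵢ` is closed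
gives a symplectic form. -/
theorem isSymplectic_of_wedgeSum {K L : Type*} [Field K] [LieRing L] [LieAlgebra K L]
    [FiniteDimensional K L] {n : ℕ} (ξ η : Fin n → Dual K L) (hdim : finrank K L = 2 * n)
    (hη : ∀ i (x y : L), η i ⁅x, y⁆ = 0)
    (hclosed : ∀ x y z : L, ∑ i, (ξ i ⁅x, y⁆ * η i z + ξ i ⁅y, z⁆ * η i x + ξ i ⁅z, x⁆ * η i y) = 0)
    (hinj : ∀ x, (∀ i, ξ i x = 0) → (∀ i, η i x = 0) → x = 0) : IsSymplectic K L := by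
  refine ⟨wedgeSum ξ η, wedgeSum_isAlt ξ η, fun x y z => ?_,
    wedgeSum_nondegenerate ξ η hdim hinj⟩
  rw [← hclosed x y z]
  simp only [wedgeSum_apply, wedge, hη, mul_zero, sub_zero, Finset.sum_add_distrib]

theorem IsSymplectic.of_equiv {K L L' : Type*} [Field K] [LieRing L] [LieAlgebra K L]
    [LieRing L'] [LieAlgebra K L'] (φ : L' ≃ₗ⁅K⁆ L) (h : IsSymplectic K L) :
    IsSymplectic K L' := by
  obtain ⟨θ, halt, hclosed, hleft, hright⟩ := h
  refine ⟨θ.compl₁₂ (φ : L' →ₗ[K] L) (φ : L' →ₗ[K] L), fun x => halt (φ x), fun x y z => ?_,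
    fun x hx => ?_, fun x hx => ?_⟩
  · have h := hclosed (φ x) (φ y) (φ z)
    simp only [← LieEquiv.map_lie] at h
    exact h
  · refine φ.injective ((hleft (φ x) fun y => ?_).trans (map_zero φ).symm)
    simpa using hx (φ.symm y)
  · refine φ.injective ((hright (φ x) fun y => ?_).trans (map_zero φ).symm)
    simpa using hx (φ.symm y)

end LieAlgebra

/-! ### The exceptional algebra is not symplectic. -/

/-- The exceptional algebra has no symplectic form: every closed form has the vector of
index `7` in its radical. -/
theorem ExceptionalAlgebra.not_isSymplectic (K : Type*) [Field K] :
    ¬ LieAlgebra.IsSymplectic K (ExceptionalAlgebra K) := by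
  rintro ⟨θ, halt, hcl, hleft, -⟩
  let e : Fin 8 → ExceptionalAlgebra K := fun i => (Pi.single i 1 : Fin 8 → K)
  have he : ∀ i j, e i j = if j = i then 1 else 0 := fun i j => by
    simp [e, Pi.single_apply]
  have hbr : ∀ i j k, ⁅e i, e j⁆ = k ↔ ∀ l, ⁅e i, e j⁆ l = k l := fun i j k =>
    ⟨fun h l => by rw [h], fun h => funext h⟩
  have hdecomp : ∀ y : ExceptionalAlgebra K, y = ∑ i, y i • e i := fun y => by
    exact pi_eq_sum_univ' (R := K) (y : Fin 8 → K)
  have h01 : ⁅e 0, e 1⁆ = e 2 := (hbr _ _ _).2 fun l => by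
    fin_cases l <;> simp [bracket_apply, he]
  have h03 : ⁅e 0, e 3⁆ = e 4 := (hbr _ _ _).2 fun l => by
    fin_cases l <;> simp [bracket_apply, he]
  have h05 : ⁅e 0, e 5⁆ = e 6 := (hbr _ _ _).2 fun l => by
    fin_cases l <;> simp [bracket_apply, he]
  have h13 : ⁅e 1, e 3⁆ = e 6 := (hbr _ _ _).2 fun l => by
    fin_cases l <;> simp [bracket_apply, he]
  have h57 : ⁅e 5, e 7⁆ = e 6 := (hbr _ _ _).2 fun l => by
    fin_cases l <;> simp [bracket_apply, he]
  have hz : ∀ i j, (i, j) ∈ ([(1, 5), (3, 5), (5, 1), (5, 3), (1, 7), (3, 7), (7, 1), (7, 3), (7, 0),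
      (5, 2), (7, 2), (2, 5), (5, 4), (7, 4), (4, 5), (2, 7), (4, 7)] : List (Fin 8 × Fin 8)) →
      ⁅e i, e j⁆ = 0 := by
    intro i j hij
    refine (hbr _ _ _).2 fun l => ?_
    simp only [List.mem_cons, Prod.mk.injEq, List.not_mem_nil, or_false] at hij
    rcases hij with h | h | h | h | h | h | h | h | h | h | h | h | h | h | h | h | h <;>
      obtain ⟨rfl, rfl⟩ := h <;> fin_cases l <;> simp [bracket_apply, he, zero_apply]
  -- The vector `e 6` is a bracket in several ways. Writing it as `⁅e 1, e 3⁆` makes it orthogonal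
  -- to `e 5` and `e 7`, which commute with `e 1` and `e 3`; writing it as `⁅e 5, e 7⁆` handles the
  -- others. For `e 0` the extra term is `θ (e 6) (e 7)`, already zero.
  have h65 : θ (e 6) (e 5) = 0 := by
    have := hcl (e 1) (e 3) (e 5)
    rwa [h13, hz 3 5 (by decide), hz 5 1 (by decide), map_zero, LinearMap.zero_apply,
      LinearMap.zero_apply, add_zero, add_zero] at this
  have h67 : θ (e 6) (e 7) = 0 := by
    have := hcl (e 1) (e 3) (e 7)
    rwa [h13, hz 3 7 (by decide), hz 7 1 (by decide), map_zero, LinearMap.zero_apply,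
      LinearMap.zero_apply, add_zero, add_zero] at this
  have h57' : ∀ j, ⁅e 7, e j⁆ = 0 → ⁅e j, e 5⁆ = 0 → θ (e 6) (e j) = 0 := fun j h1 h2 => by
    have := hcl (e 5) (e 7) (e j)
    rwa [h57, h1, h2, map_zero, LinearMap.zero_apply, LinearMap.zero_apply, add_zero,
      add_zero] at this
  have h60 : θ (e 6) (e 0) = 0 := by
    have := hcl (e 5) (e 7) (e 0)
    rwa [h57, h05, hz 7 0 (by decide), map_zero, LinearMap.zero_apply, h67, add_zero,
      add_zero] at this
  have h6 : ∀ j, θ (e 6) (e j) = 0 := by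
    intro j
    fin_cases j
    · exact h60
    · exact h57' 1 (hz _ _ (by decide)) (hz _ _ (by decide))
    · exact h57' 2 (hz _ _ (by decide)) (hz _ _ (by decide))
    · exact h57' 3 (hz _ _ (by decide)) (hz _ _ (by decide))
    · exact h57' 4 (hz _ _ (by decide)) (hz _ _ (by decide))
    · exact h65
    · exact halt (e 6)
    · exact h67
  have h0 : e 6 = 0 := hleft (e 6) fun y => by
    rw [hdecomp y, map_sum]
    exact Finset.sum_eq_zero fun i _ => by rw [map_smul, h6, smul_zero]
  have := he 6 6
  rw [h0, zero_apply, if_pos rfl] at this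
  exact zero_ne_one this

/-! ### Three-dimensional derived algebra: symplectic forms from the matrices `P` and `Q`. -/

namespace LieAlgebra

open Module

/-- A coframe `e, a₁, a₂, a₃, f, ζ₁, ζ₂, ζ₃` in which the bracket is given by
`ζᵢ[·,·] = e ∧ aᵢ + ∑ⱼ Pᵢⱼ ⋆aⱼ + ∑ⱼ Qᵢⱼ aⱼ ∧ f`, the other forms being closed. -/
structure Coframe₃ (K : Type*) {L : Type*} [Field K] [LieRing L] [LieAlgebra K L]
    (e f : Dual K L) (a ζ : Fin 3 → Dual K L) (P Q : Fin 3 → Fin 3 → K) : Prop where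
  inj : ∀ x, e x = 0 → f x = 0 → (∀ i, a i x = 0) → (∀ i, ζ i x = 0) → x = 0
  e_lie : ∀ x y : L, e ⁅x, y⁆ = 0
  f_lie : ∀ x y : L, f ⁅x, y⁆ = 0
  a_lie : ∀ i, ∀ x y : L, a i ⁅x, y⁆ = 0
  ζ_lie : ∀ i, ∀ x y : L, ζ i ⁅x, y⁆ = wedge e (a i) x y
    + (P i 0 * wedge (a 1) (a 2) x y + P i 1 * wedge (a 2) (a 0) x y
      + P i 2 * wedge (a 0) (a 1) x y)
    + (Q i 0 * wedge (a 0) f x y + Q i 1 * wedge (a 1) f x y + Q i 2 * wedge (a 2) f x y)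

namespace Coframe₃

variable {K L : Type*} [Field K] [LieRing L] [LieAlgebra K L] [FiniteDimensional K L]
  {e f : Dual K L} {a ζ : Fin 3 → Dual K L} {P Q : Fin 3 → Fin 3 → K}

/-- The forms `bᵢ = tᵢ e + ∑ⱼ Mᵢⱼ aⱼ + nᵢ f` with `∑ᵢ ζᵢ ∧ bᵢ` closed, completed to a basis of
the span of `e, a₁, a₂, a₃, f` by two forms `φ, ψ`, give a symplectic form. -/
theorem isSymplectic_of_coeff (h : Coframe₃ K e f a ζ P Q) (hdim : finrank K L = 8)
    (t n : Fin 3 → K) (M : Fin 3 → Fin 3 → K)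
    (hn : ∀ j, n j + (t 0 * Q 0 j + t 1 * Q 1 j + t 2 * Q 2 j) = 0)
    (hM0 : t 0 * P 0 0 + t 1 * P 1 0 + t 2 * P 2 0 + (M 1 2 - M 2 1) = 0)
    (hM1 : t 0 * P 0 1 + t 1 * P 1 1 + t 2 * P 2 1 + (M 2 0 - M 0 2) = 0)
    (hM2 : t 0 * P 0 2 + t 1 * P 1 2 + t 2 * P 2 2 + (M 0 1 - M 1 0) = 0)
    (htr : P 0 0 * M 0 0 + P 0 1 * M 0 1 + P 0 2 * M 0 2 + P 1 0 * M 1 0 + P 1 1 * M 1 1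
      + P 1 2 * M 1 2 + P 2 0 * M 2 0 + P 2 1 * M 2 1 + P 2 2 * M 2 2 = 0)
    (hQ0 : (P 0 0 * n 0 + P 1 0 * n 1 + P 2 0 * n 2)
      - (Q 0 1 * M 0 2 + Q 1 1 * M 1 2 + Q 2 1 * M 2 2)
      + (Q 0 2 * M 0 1 + Q 1 2 * M 1 1 + Q 2 2 * M 2 1) = 0)
    (hQ1 : (P 0 1 * n 0 + P 1 1 * n 1 + P 2 1 * n 2)
      - (Q 0 2 * M 0 0 + Q 1 2 * M 1 0 + Q 2 2 * M 2 0)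
      + (Q 0 0 * M 0 2 + Q 1 0 * M 1 2 + Q 2 0 * M 2 2) = 0)
    (hQ2 : (P 0 2 * n 0 + P 1 2 * n 1 + P 2 2 * n 2)
      - (Q 0 0 * M 0 1 + Q 1 0 * M 1 1 + Q 2 0 * M 2 1)
      + (Q 0 1 * M 0 0 + Q 1 1 * M 1 0 + Q 2 1 * M 2 0) = 0)
    (φ ψ : Dual K L) (hφ : ∀ x y : L, φ ⁅x, y⁆ = 0) (hψ : ∀ x y : L, ψ ⁅x, y⁆ = 0)
    (hinj : ∀ x, φ x = 0 → ψ x = 0 →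
      (∀ i, t i * e x + (M i 0 * a 0 x + M i 1 * a 1 x + M i 2 * a 2 x) + n i * f x = 0) →
      e x = 0 ∧ f x = 0 ∧ ∀ i, a i x = 0) :
    IsSymplectic K L := by
  let b : Fin 3 → Dual K L := fun i =>
    t i • e + (M i 0 • a 0 + M i 1 • a 1 + M i 2 • a 2) + n i • f
  have hb : ∀ i x, b i x =
      t i * e x + (M i 0 * a 0 x + M i 1 * a 1 x + M i 2 * a 2 x) + n i * f x := fun i x => by
    simp [b]
  have hbl : ∀ i (x y : L), b i ⁅x, y⁆ = 0 := fun i x y => by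
    simp [hb, h.e_lie, h.f_lie, h.a_lie]
  refine isSymplectic_of_wedgeSum (n := 4) ![ζ 0, ζ 1, ζ 2, φ] ![b 0, b 1, b 2, ψ]
    (by rw [hdim]) ?_ ?_ ?_
  · intro i x y
    fin_cases i
    exacts [hbl 0 x y, hbl 1 x y, hbl 2 x y, hψ x y]
  · intro x y z
    simp only [Fin.sum_univ_four, Matrix.cons_val, hφ, h.ζ_lie, hb, wedge]
    -- `D α β γ` is `α ∧ β ∧ γ` evaluated at `x, y, z`. The ten coefficient hypotheses correspond to
    -- the ten 3-forms built from `e, a₁, a₂, a₃, f`.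
    let D (α β γ : Dual K L) : K := α x * (β y * γ z - β z * γ y)
      - α y * (β x * γ z - β z * γ x) + α z * (β x * γ y - β y * γ x)
    linear_combination (exp := 1) hM0 * D e (a 1) (a 2) + hM1 * D e (a 2) (a 0)
      + hM2 * D e (a 0) (a 1) + hn 0 * D e (a 0) f + hn 1 * D e (a 1) f + hn 2 * D e (a 2) f
      + htr * D (a 0) (a 1) (a 2) + hQ0 * D (a 1) (a 2) f + hQ1 * D (a 2) (a 0) f
      + hQ2 * D (a 0) (a 1) f
  · intro x hξ hη
    have h1 := hinj x (hξ 3) (hη 3) fun i => by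
      rw [← hb]
      fin_cases i
      exacts [hη 0, hη 1, hη 2]
    refine h.inj x h1.1 h1.2.1 h1.2.2 fun i => ?_
    fin_cases i
    exacts [hξ 0, hξ 1, hξ 2]

/-- An invertible symmetric matrix `S` with `tr (P S) = 0` and `S Q` symmetric gives a symplectic
form. -/
theorem isSymplectic_of_symm (h : Coframe₃ K e f a ζ P Q) (hdim : finrank K L = 8)
    (s00 s01 s02 s11 s12 s22 : K)
    (htr : P 0 0 * s00 + (P 0 1 + P 1 0) * s01 + (P 0 2 + P 2 0) * s02 + P 1 1 * s11
      + (P 1 2 + P 2 1) * s12 + P 2 2 * s22 = 0)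
    (hQ0 : Q 0 2 * s01 + Q 1 2 * s11 + Q 2 2 * s12 = Q 0 1 * s02 + Q 1 1 * s12 + Q 2 1 * s22)
    (hQ1 : Q 0 0 * s02 + Q 1 0 * s12 + Q 2 0 * s22 = Q 0 2 * s00 + Q 1 2 * s01 + Q 2 2 * s02)
    (hQ2 : Q 0 1 * s00 + Q 1 1 * s01 + Q 2 1 * s02 = Q 0 0 * s01 + Q 1 0 * s11 + Q 2 0 * s12)
    (hdet : s00 * (s11 * s22 - s12 * s12) - s01 * (s01 * s22 - s12 * s02)
      + s02 * (s01 * s12 - s11 * s02) ≠ 0) :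
    IsSymplectic K L := by
  refine h.isSymplectic_of_coeff hdim 0 0 ![![s00, s01, s02], ![s01, s11, s12], ![s02, s12, s22]]
    (by simp) (by simp) (by simp) (by simp) ?_ ?_ ?_ ?_ e f h.e_lie h.f_lie ?_
  · simp only [Matrix.cons_val]
    linear_combination htr
  · simp only [Matrix.cons_val, Pi.zero_apply]
    linear_combination hQ0
  · simp only [Matrix.cons_val, Pi.zero_apply]
    linear_combination hQ1
  · simp only [Matrix.cons_val, Pi.zero_apply]
    linear_combination hQ2
  · intro x he hf hb
    have h0 := hb 0
    have h1 := hb 1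
    have h2 := hb 2
    simp only [Matrix.cons_val, Pi.zero_apply, zero_mul, zero_add, add_zero] at h0 h1 h2
    -- Cramer's rule: the combinations below use the rows of the adjugate of the symmetric matrix.
    refine ⟨he, hf, fun i => (mul_eq_zero.1 ?_).resolve_left hdet⟩
    fin_cases i
    · change _ * a 0 x = 0
      linear_combination (s11 * s22 - s12 * s12) * h0 - (s01 * s22 - s12 * s02) * h1
        + (s01 * s12 - s11 * s02) * h2
    · change _ * a 1 x = 0
      linear_combination -(s01 * s22 - s12 * s02) * h0 + (s00 * s22 - s02 * s02) * h1
        - (s00 * s12 - s01 * s02) * h2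
    · change _ * a 2 x = 0
      linear_combination (s01 * s12 - s11 * s02) * h0 - (s00 * s12 - s01 * s02) * h1
        + (s00 * s11 - s01 * s01) * h2

/-- A nonempty affine plane is not contained in the cone `xz = y²`; the hypothesis says that the
solution set is nonempty. If `p ≠ 0`, put `z = 1` and solve for `x`: having `x = y²` for all `y`
would make a quadratic polynomial with leading coefficient `p` vanish identically, and its second
difference is `2p`. -/
theorem exists_affine_eq_zero_and_disc_ne_zero {F : Type*} [Field F] [CharZero F] (c p q r : F)
    (h : c = 0 ∨ p ≠ 0 ∨ r ≠ 0 ∨ q ≠ 0) :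
    ∃ x y z : F, c + p * x + q * y + r * z = 0 ∧ x * z - y * y ≠ 0 := by
  have key : ∀ p r : F, p ≠ 0 → ∃ x y z : F, c + p * x + q * y + r * z = 0 ∧ x * z - y * y ≠ 0 := by
    intro p r hp
    by_contra! H
    have H' : ∀ y, c + q * y + r + p * (y * y) = 0 := fun y => by
      have h1 := H (-(c + q * y + r) / p) y 1 (by field_simp; ring)
      field_simp at h1
      linear_combination -h1
    have h2 : 2 * p = 0 := by linear_combination H' 1 + H' (-1) - 2 * H' 0
    exact hp ((mul_eq_zero.1 h2).resolve_left two_ne_zero)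
  by_cases hp : p = 0
  · by_cases hr : r = 0
    · by_cases hq : q = 0
      · have hc : c = 0 := by simpa [hp, hr, hq] using h
        exact ⟨1, 0, 1, by simp [hp, hr, hq, hc], by simp⟩
      · refine ⟨1, -c / q, (-c / q) * (-c / q) + 1, ?_, by simp⟩
        rw [hp, hr]
        field_simp
        ring
    · obtain ⟨x, y, z, h1, h2⟩ := key r p hr
      exact ⟨z, y, x, by linear_combination h1, fun h3 => h2 (by linear_combination h3)⟩
  · exact key p r hp

theorem isSymplectic_of_zero [CharZero K] (h : Coframe₃ K e f a ζ P Q) (hdim : finrank K L = 8)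
    (hQ : ∀ i j, Q i j = 0) : IsSymplectic K L := by
  by_cases hP : P 0 0 = 0 ∨ P 1 1 ≠ 0 ∨ P 2 2 ≠ 0 ∨ P 1 2 + P 2 1 ≠ 0
  · obtain ⟨x, y, z, h1, h2⟩ := exists_affine_eq_zero_and_disc_ne_zero _ _ _ _ hP
    refine h.isSymplectic_of_symm hdim 1 0 0 x y z ?_ (by simp [hQ]) (by simp [hQ]) (by simp [hQ])
      fun h3 => h2 (by linear_combination h3)
    linear_combination h1
  -- Now `P 2 2 = 0`, so the entry `s22 = 1` is free in the trace, and the equation left for the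
  -- block on indices 0 and 1 is homogeneous.
  · push Not at hP
    obtain ⟨x, y, z, h1, h2⟩ := exists_affine_eq_zero_and_disc_ne_zero 0 (P 0 0) (P 0 1 + P 1 0)
      (P 1 1) (Or.inl rfl)
    refine h.isSymplectic_of_symm hdim x y 0 z 0 1 ?_ (by simp [hQ]) (by simp [hQ]) (by simp [hQ])
      fun h3 => h2 (by linear_combination h3)
    linear_combination h1 + hP.2.2.1

/-- `Q` is a companion matrix, so Hankel matrices `λ(X^(i+j))`, with `λ` a linear form on `K[X]`
modulo the characteristic polynomial of `Q`, make `S Q` symmetric. If the one used here violates the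
trace condition, its nonzero trace against `P` serves as the slope of an affine equation. -/
theorem isSymplectic_of_cyclic (h : Coframe₃ K e f a ζ P Q) (hdim : finrank K L = 8)
    (h00 : Q 0 0 = 0) (h10 : Q 1 0 = 1) (h20 : Q 2 0 = 0)
    (h01 : Q 0 1 = 0) (h11 : Q 1 1 = 0) (h21 : Q 2 1 = 1) : IsSymplectic K L := by
  by_cases hα : (P 0 2 + P 2 0) + P 1 1 + (P 1 2 + P 2 1) * Q 2 2
      + P 2 2 * (Q 1 2 + Q 2 2 * Q 2 2) = 0
  -- Here `λ` is the coefficient of `X²`: the Hankel matrix is antitriangular of determinant `-1`,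
  -- and its last entries are `λ(X³)` and `λ(X⁴)`.
  · refine h.isSymplectic_of_symm hdim 0 0 1 1 (Q 2 2) (Q 1 2 + Q 2 2 * Q 2 2) ?_ ?_ ?_ ?_ ?_
    · linear_combination hα
    · rw [h01, h11, h21]; ring
    · rw [h00, h10, h20]; ring
    · rw [h00, h10, h20, h01, h11, h21]; ring
    · norm_num
  -- Taking `t = (0, 0, 1)` forces `n` to be minus the last row of `Q`. With first row `(1, 0, r)`,
  -- the other entries solve the linear equations apart from the trace one. Since `N r - N 0` is `r`
  -- times the Hankel matrix above, `T` is affine in `r` with nonzero slope.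
  · let N (r : K) : Fin 3 → Fin 3 → K :=
      let m10 := P 2 2
      let m20 := r - P 2 1
      let m11 := m20 - P 1 2 - Q 2 2 * P 2 2
      let m12 := P 1 1 + Q 2 2 * P 2 1 + Q 0 2 + Q 1 2 * m10 + Q 2 2 * m20
      let m21 := m12 + P 2 0
      ![![1, 0, r], ![m10, m11, m12],
        ![m20, m21, - P 1 0 - Q 2 2 * P 2 0 + Q 1 2 * m11 + Q 2 2 * m21]]
    let T (r : K) : K := P 0 0 * N r 0 0 + P 0 1 * N r 0 1 + P 0 2 * N r 0 2 + P 1 0 * N r 1 0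
      + P 1 1 * N r 1 1 + P 1 2 * N r 1 2 + P 2 0 * N r 2 0 + P 2 1 * N r 2 1 + P 2 2 * N r 2 2
    have hT : ∀ r, T r = r * ((P 0 2 + P 2 0) + P 1 1 + (P 1 2 + P 2 1) * Q 2 2
      + P 2 2 * (Q 1 2 + Q 2 2 * Q 2 2)) + T 0 := fun r => by
      simp only [T, N, Matrix.cons_val]
      ring
    obtain ⟨r, hr⟩ : ∃ r, T r = 0 := ⟨-T 0 / _, by rw [hT, div_mul_cancel₀ _ hα, neg_add_cancel]⟩
    refine h.isSymplectic_of_coeff hdim ![0, 0, 1] ![0, -1, - Q 2 2] (N r)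
      ?_ ?_ ?_ ?_ hr ?_ ?_ ?_ (a 1) (a 2) (h.a_lie 1) (h.a_lie 2) ?_
    · intro j
      fin_cases j <;> simp [h20, h21]
    · simp only [N, Matrix.cons_val]; ring
    · simp only [N, Matrix.cons_val]; ring
    · simp only [N, Matrix.cons_val]; ring
    · simp only [N, Matrix.cons_val, h01, h11, h21]; ring
    · simp only [N, Matrix.cons_val, h00, h10, h20]; ring
    · simp only [N, Matrix.cons_val, h00, h10, h20, h01, h11, h21]; ring
    · intro x h1 h2 hb
      have hb0 := hb 0
      have hb1 := hb 1
      have hb2 := hb 2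
      simp only [N, Matrix.cons_val] at hb0 hb1 hb2
      have h0 : a 0 x = 0 := by linear_combination hb0 - r * h2
      simp only [h0, h1, h2, mul_zero, add_zero, zero_add, zero_mul, neg_mul, one_mul,
        neg_eq_zero] at hb1 hb2
      rw [hb1, mul_zero, neg_zero, add_zero] at hb2
      refine ⟨hb2, hb1, fun i => ?_⟩
      fin_cases i
      exacts [h0, h1, h2]

/-- For `Q = E₀₁`, `S Q` is symmetric when `s00 = s02 = 0`. Normalizing `s01 = s22 = 1` leaves
`s11`, `s12` to meet the trace condition. If they cannot, their coefficients vanish and `P 0 1 + P 1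
0 + P 2 2 ≠ 0`, which makes a solution with `t = (1, 0, 0)` available. -/
theorem isSymplectic_of_nilpotent (h : Coframe₃ K e f a ζ P Q) (hdim : finrank K L = 8)
    (hQ : ∀ i j, Q i j = if i = 0 ∧ j = 1 then 1 else 0) : IsSymplectic K L := by
  by_cases hS : ∃ x y, (P 0 1 + P 1 0) + P 1 1 * x + (P 1 2 + P 2 1) * y + P 2 2 = 0
  · obtain ⟨x, y, hxy⟩ := hS
    refine h.isSymplectic_of_symm hdim 0 1 0 x y 1 ?_ (by simp [hQ]) (by simp [hQ]) (by simp [hQ])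
      (by norm_num)
    linear_combination hxy
  have h11 : P 1 1 = 0 := by
    by_contra h0
    exact hS ⟨-(P 0 1 + P 1 0 + P 2 2) / P 1 1, 0, by field_simp; ring⟩
  have h12 : P 1 2 + P 2 1 = 0 := by
    by_contra h0
    exact hS ⟨0, -(P 0 1 + P 1 0 + P 2 2) / (P 1 2 + P 2 1), by field_simp; ring⟩
  -- The parameters `u`, `v` enter through `E₀₁ + E₁₀` and `E₂₂`, so they appear in the trace with
  -- coefficients `P 0 1 + P 1 0` and `P 2 2`, not both zero.
  let N (u v : K) : Fin 3 → Fin 3 → K :=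
    ![![P 1 2, u, -P 1 0], ![u + P 0 2, 0, 1 - P 0 0], ![-P 1 0 - P 0 1, 1, v]]
  let T (u v : K) : K := P 0 0 * N u v 0 0 + P 0 1 * N u v 0 1 + P 0 2 * N u v 0 2
    + P 1 0 * N u v 1 0 + P 1 1 * N u v 1 1 + P 1 2 * N u v 1 2 + P 2 0 * N u v 2 0
    + P 2 1 * N u v 2 1 + P 2 2 * N u v 2 2
  have hT : ∀ u v, T u v = T 0 0 + (P 0 1 + P 1 0) * u + P 2 2 * v := fun u v => by
    simp only [T, N, Matrix.cons_val]
    ring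
  obtain ⟨u, v, huv⟩ : ∃ u v, T u v = 0 := by
    by_cases h22 : P 2 2 = 0
    · have h01 : P 0 1 + P 1 0 ≠ 0 := fun h0 => hS ⟨0, 0, by rw [h0, h22]; ring⟩
      exact ⟨-T 0 0 / (P 0 1 + P 1 0), 0, by rw [hT]; field_simp; ring⟩
    · exact ⟨0, -T 0 0 / P 2 2, by rw [hT]; field_simp; ring⟩
  refine h.isSymplectic_of_coeff hdim ![1, 0, 0] ![0, -1, 0] (N u v)
    ?_ ?_ ?_ ?_ huv ?_ ?_ ?_ (a 0) (a 2) (h.a_lie 0) (h.a_lie 2) ?_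
  · intro j
    fin_cases j <;> simp [hQ]
  · simp only [N, Matrix.cons_val]; ring
  · simp only [N, Matrix.cons_val]; ring
  · simp only [N, Matrix.cons_val]; ring
  · simp [N, hQ]
  · simp [N, hQ, h11]
  · simp [N, hQ]
  · intro x h0 h2 hb
    have hb0 := hb 0
    have hb1 := hb 1
    have hb2 := hb 2
    simp only [N, Matrix.cons_val] at hb0 hb1 hb2
    have h1 : a 1 x = 0 := by linear_combination hb2 - (-P 1 0 - P 0 1) * h0 - v * h2
    simp only [h0, h1, h2, mul_zero, add_zero, zero_add, zero_mul, neg_mul, one_mul,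
      neg_eq_zero] at hb0 hb1
    refine ⟨hb0, hb1, fun i => ?_⟩
    fin_cases i
    exacts [h0, h1, h2]

/-- A block matrix `diag(1, S')` makes `S Q` symmetric, and the trace condition becomes one affine
equation on the 2×2 block `S'`. -/
theorem isSymplectic_of_diagonal [CharZero K] (h : Coframe₃ K e f a ζ P Q)
    (hdim : finrank K L = 8) (l : K)
    (hQ : ∀ i j, Q i j = if i = 0 ∧ j = 0 then l else 0)
    (hP : P 0 0 = 0 ∨ P 1 1 ≠ 0 ∨ P 2 2 ≠ 0 ∨ P 1 2 + P 2 1 ≠ 0) : IsSymplectic K L := by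
  obtain ⟨x, y, z, h1, h2⟩ := exists_affine_eq_zero_and_disc_ne_zero _ _ _ _ hP
  refine h.isSymplectic_of_symm hdim 1 0 0 x y z ?_ (by simp [hQ]) (by simp [hQ]) (by simp [hQ])
    fun h3 => h2 (by linear_combination h3)
  linear_combination h1

/-- Since `-P 2 1 = P 1 2`, a single correction of `e` absorbs the `P`-terms of both `ζ 1` and `ζ
2`. What remains in `ζ 0` is `P 0 0` times `a 1 ∧ a 2` plus a multiple of `a 0`, whose cofactor is
the corrected `f`. Dividing `a 0` and `ζ 0` by `P 0 0` normalizes the constants. -/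
theorem nonempty_equiv_exceptionalAlgebra (h : Coframe₃ K e f a ζ P Q)
    (hdim : finrank K L = 8) (l : K) (hl : l ≠ 0)
    (hQ : ∀ i j, Q i j = if i = 0 ∧ j = 0 then l else 0)
    (h00 : P 0 0 ≠ 0) (h11 : P 1 1 = 0) (h22 : P 2 2 = 0) (h12 : P 1 2 + P 2 1 = 0) :
    Nonempty (L ≃ₗ⁅K⁆ ExceptionalAlgebra K) := by
  let p := P 0 0
  let g : Fin 8 → Dual K L :=
    ![e + P 1 2 • a 0 + P 2 0 • a 1 - P 1 0 • a 2, a 1, ζ 1, a 2, ζ 2, p⁻¹ • a 0, p⁻¹ • ζ 0,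
      l • f + (P 0 2 + P 2 0) • a 1 - (P 0 1 + P 1 0) • a 2]
  let Ψ : L →ₗ[K] (Fin 8 → K) := LinearMap.pi g
  have hΨ : Function.Injective Ψ := by
    rw [injective_iff_map_eq_zero]
    intro x hx
    have hg : ∀ i, g i x = 0 := fun i => congrFun hx i
    have ha1 : a 1 x = 0 := hg 1
    have ha2 : a 2 x = 0 := hg 3
    have ha0 : a 0 x = 0 := (mul_eq_zero.1 (hg 5)).resolve_left (inv_ne_zero h00)
    have hz0 : ζ 0 x = 0 := (mul_eq_zero.1 (hg 6)).resolve_left (inv_ne_zero h00)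
    have he := hg 0
    have hf := hg 7
    simp only [g, Matrix.cons_val, LinearMap.sub_apply, LinearMap.add_apply, LinearMap.smul_apply,
      smul_eq_mul, ha0, ha1, ha2, mul_zero, add_zero, sub_zero] at he hf
    refine h.inj x he ((mul_eq_zero.1 hf).resolve_left hl) (fun i => ?_) (fun i => ?_)
    · fin_cases i
      exacts [ha0, ha1, ha2]
    · fin_cases i
      exacts [hz0, hg 2, hg 4]
  have hbij : Function.Bijective Ψ :=
    ⟨hΨ, (LinearMap.injective_iff_surjective_of_finrank_eq_finrank (by simp [hdim])).1 hΨ⟩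
  let Ψ' : L →ₗ[K] ExceptionalAlgebra K := Ψ
  have hc : ∀ i (z : L), Ψ' z i = g i z := fun _ _ => rfl
  let Φ : L →ₗ⁅K⁆ ExceptionalAlgebra K :=
    { Ψ' with
      map_lie' := by
        intro x y
        have hp : p⁻¹ * P 0 0 = 1 := inv_mul_cancel₀ h00
        funext i
        change Ψ' ⁅x, y⁆ i = ⁅Ψ' x, Ψ' y⁆ i
        rw [ExceptionalAlgebra.bracket_apply]
        simp only [hc]
        fin_cases i <;>
          simp [g, h.e_lie, h.f_lie, h.a_lie, h.ζ_lie, wedge, hQ, h11, h22]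
        · ring
        · linear_combination (a 0 x * a 2 y - a 2 x * a 0 y) * (-h12)
        · linear_combination (a 1 x * a 2 y - a 2 x * a 1 y) * hp }
  exact ⟨LieEquiv.ofBijective Φ hbij⟩

end Coframe₃

end LieAlgebra

/-! ### Adapted bases, and the case of a four-dimensional derived algebra. -/

namespace LieAlgebra

open Module

variable {K L : Type*} [Field K] [LieRing L] [LieAlgebra K L]

theorem lie_eq_zero_of_mem_span {S : Set L} (hS : ∀ X : L, ∀ d ∈ S, ⁅X, d⁆ = 0) (X : L) {d : L}
    (hd : d ∈ Submodule.span K S) : ⁅X, d⁆ = 0 := by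
  induction hd using Submodule.span_induction with
  | mem d hd => exact hS X d hd
  | zero => exact lie_zero X
  | add d d' _ _ h h' => rw [lie_add, h, h', add_zero]
  | smul c d _ h => rw [lie_smul, h, smul_zero]

theorem coeff_eq_zero_of_linearIndependent {V : Type*} [AddCommGroup V] [Module K V]
    {z : Fin 3 → V} (hz : LinearIndependent K z) {c₀ c₁ c₂ : K}
    (h : c₀ • z 0 + c₁ • z 1 + c₂ • z 2 = 0) : c₀ = 0 ∧ c₁ = 0 ∧ c₂ = 0 := by
  have := Fintype.linearIndependent_iff.1 hz ![c₀, c₁, c₂] (by simpa [Fin.sum_univ_three] using h)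
  exact ⟨this 0, this 1, this 2⟩

/-- The coframe is the dual basis of `x, w, vᵢ, ⁅x, vᵢ⁆`, and `P` records the brackets `⁅vᵢ, vⱼ⁆`.
For independence, `ad x` kills all of these vectors except the `vᵢ`; the rest follows from `w ∉ K x
+ S`. -/
theorem exists_coframe₃ [FiniteDimensional K L] (hdim : finrank K L = 8)
    (hnil : ∀ X Y Z : L, ⁅X, ⁅Y, Z⁆⁆ = 0) {x w : L} {v : Fin 3 → L}
    (hz : LinearIndependent K fun i => ⁅x, v i⁆)
    (hD : ∀ X Y : L, ⁅X, Y⁆ ∈ Submodule.span K (Set.range fun i => ⁅x, v i⁆))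
    (hw : ⁅x, w⁆ = 0) (hw' : ∀ s : K, w - s • x ∉ Submodule.span K (Set.range fun i => ⁅x, v i⁆))
    (Q : Fin 3 → Fin 3 → K)
    (hQ : ∀ j, ⁅v j, w⁆ = Q 0 j • ⁅x, v 0⁆ + Q 1 j • ⁅x, v 1⁆ + Q 2 j • ⁅x, v 2⁆) :
    ∃ (e f : Dual K L) (a ζ : Fin 3 → Dual K L) (P : Fin 3 → Fin 3 → K),
      Coframe₃ K e f a ζ P Q := by
  set S := Submodule.span K (Set.range fun i => ⁅x, v i⁆) with hS
  have hzS : ∀ i, ⁅x, v i⁆ ∈ S := fun i => Submodule.subset_span ⟨i, rfl⟩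
  have hcent : ∀ X : L, ∀ d ∈ S, ⁅X, d⁆ = 0 := fun X d hd =>
    lie_eq_zero_of_mem_span (by rintro X _ ⟨i, rfl⟩; exact hnil _ _ _) X hd
  have hxS : x ∉ S := fun hx => hz.ne_zero 0 (by
    change ⁅x, v 0⁆ = 0
    rw [← lie_skew, hcent _ _ hx, neg_zero])
  let B : Fin 8 → L := ![x, w, v 0, v 1, v 2, ⁅x, v 0⁆, ⁅x, v 1⁆, ⁅x, v 2⁆]
  have hB : LinearIndependent K B := by
    rw [Fintype.linearIndependent_iff]
    intro g hg
    simp only [B, Fin.sum_univ_eight, Matrix.cons_val] at hg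
    have hd : g 5 • ⁅x, v 0⁆ + g 6 • ⁅x, v 1⁆ + g 7 • ⁅x, v 2⁆ ∈ S :=
      S.add_mem (S.add_mem (S.smul_mem _ (hzS 0)) (S.smul_mem _ (hzS 1))) (S.smul_mem _ (hzS 2))
    have h1 := congrArg (fun y => ⁅x, y⁆) hg
    simp only [lie_add, lie_smul, lie_self, hw, hnil, smul_zero, zero_add, add_zero,
      lie_zero] at h1
    obtain ⟨h2, h3, h4⟩ := coeff_eq_zero_of_linearIndependent hz h1
    have hg1 : g 1 = 0 := by
      by_contra hne
      apply hw' (-(g 1)⁻¹ * g 0)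
      have : w - (-(g 1)⁻¹ * g 0) • x
          = (-(g 1)⁻¹) • (g 5 • ⁅x, v 0⁆ + g 6 • ⁅x, v 1⁆ + g 7 • ⁅x, v 2⁆) := by
        have hg' : g 5 • ⁅x, v 0⁆ + g 6 • ⁅x, v 1⁆ + g 7 • ⁅x, v 2⁆ = -(g 0 • x + g 1 • w) := by
          rw [h2, h3, h4] at hg
          rw [eq_neg_iff_add_eq_zero, ← hg]
          module
        rw [hg', smul_neg, smul_add, smul_smul, smul_smul, neg_mul (g 1)⁻¹ (g 1),
          inv_mul_cancel₀ hne]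
        module
      rw [this]
      exact S.smul_mem _ hd
    have hg0 : g 0 = 0 := by
      by_contra hne
      apply hxS
      have : g 0 • x = -(g 5 • ⁅x, v 0⁆ + g 6 • ⁅x, v 1⁆ + g 7 • ⁅x, v 2⁆) := by
        rw [hg1, h2, h3, h4] at hg
        rw [eq_neg_iff_add_eq_zero, ← hg]
        module
      have h5 : g 0 • x ∈ S := by
        rw [this]
        exact S.neg_mem hd
      exact (S.smul_mem_iff hne).1 h5
    obtain ⟨h5, h6, h7⟩ := coeff_eq_zero_of_linearIndependent hz
      (c₀ := g 5) (c₁ := g 6) (c₂ := g 7) (by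
        rw [hg0, hg1, h2, h3, h4] at hg
        rw [← hg]
        module)
    intro i
    fin_cases i
    exacts [hg0, hg1, h2, h3, h4, h5, h6, h7]
  let b := basisOfLinearIndependentOfCardEqFinrank hB (by rw [hdim, Fintype.card_fin])
  have hb : ∀ i, b i = B i := fun i => by simp [b]
  have hbB : ∀ i j, b.coord i (B j) = if j = i then 1 else 0 := fun i j => by
    rw [← hb, b.coord_apply, b.repr_self, Finsupp.single_apply]
  have hcS : ∀ i, (i : Fin 8) < 5 → ∀ X Y : L, b.coord i ⁅X, Y⁆ = 0 := by
    intro i hi X Y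
    have : S ≤ LinearMap.ker (b.coord i) := by
      rw [hS, Submodule.span_le]
      rintro _ ⟨j, rfl⟩
      rw [SetLike.mem_coe, LinearMap.mem_ker]
      fin_cases j
      · exact (hbB i 5).trans (if_neg (by rintro rfl; revert hi; decide))
      · exact (hbB i 6).trans (if_neg (by rintro rfl; revert hi; decide))
      · exact (hbB i 7).trans (if_neg (by rintro rfl; revert hi; decide))
    exact this (hD X Y)
  let ζ : Fin 3 → Dual K L := ![b.coord 5, b.coord 6, b.coord 7]
  refine ⟨b.coord 0, b.coord 1, ![b.coord 2, b.coord 3, b.coord 4], ζ,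
    fun i => ![ζ i ⁅v 1, v 2⁆, ζ i ⁅v 2, v 0⁆, ζ i ⁅v 0, v 1⁆], ?_, ?_, ?_, ?_, ?_⟩
  · intro X h0 h1 ha hζ
    refine b.forall_coord_eq_zero_iff.1 fun i => ?_
    fin_cases i
    exacts [h0, h1, ha 0, ha 1, ha 2, hζ 0, hζ 1, hζ 2]
  · exact hcS 0 (by decide)
  · exact hcS 1 (by decide)
  · intro i
    fin_cases i
    exacts [hcS 2 (by decide), hcS 3 (by decide), hcS 4 (by decide)]
  · intro i X Y
    have hdec : ∀ X : L, ∃ d ∈ S, X = b.coord 0 X • x + b.coord 1 X • w + b.coord 2 X • v 0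
        + b.coord 3 X • v 1 + b.coord 4 X • v 2 + d := fun X => by
      refine ⟨b.coord 5 X • ⁅x, v 0⁆ + b.coord 6 X • ⁅x, v 1⁆ + b.coord 7 X • ⁅x, v 2⁆,
        S.add_mem (S.add_mem (S.smul_mem _ (hzS 0)) (S.smul_mem _ (hzS 1)))
        (S.smul_mem _ (hzS 2)), ?_⟩
      conv_lhs => rw [← b.sum_repr X]
      simp only [Fin.sum_univ_eight, hb, b.coord_apply, B, Matrix.cons_val]
      module
    obtain ⟨d, hd, hX⟩ := hdec X
    obtain ⟨d', hd', hY⟩ := hdec Y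
    have hζz : ∀ j, ζ i ⁅x, v j⁆ = if j = i then 1 else 0 := by
      intro j
      fin_cases i <;> fin_cases j
      exacts [hbB 5 5, hbB 5 6, hbB 5 7, hbB 6 5, hbB 6 6, hbB 6 7, hbB 7 5, hbB 7 6, hbB 7 7]
    have hd1 : ∀ Z : L, ⁅d, Z⁆ = 0 := fun Z => by rw [← lie_skew, hcent _ _ hd, neg_zero]
    have hd2 : ∀ Z : L, ⁅Z, d'⁆ = 0 := fun Z => hcent _ _ hd'
    have hwx : ⁅w, x⁆ = 0 := by rw [← lie_skew, hw, neg_zero]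
    have hvx : ∀ j, ⁅v j, x⁆ = -⁅x, v j⁆ := fun j => (lie_skew _ _).symm
    have hwv : ∀ j, ⁅w, v j⁆ = -⁅v j, w⁆ := fun j => (lie_skew _ _).symm
    have h10 : ⁅v 1, v 0⁆ = -⁅v 0, v 1⁆ := (lie_skew _ _).symm
    have h21 : ⁅v 2, v 1⁆ = -⁅v 1, v 2⁆ := (lie_skew _ _).symm
    have h02 : ⁅v 0, v 2⁆ = -⁅v 2, v 0⁆ := (lie_skew _ _).symm
    have hlie : ζ i ⁅X, Y⁆ = ζ i ⁅b.coord 0 X • x + b.coord 1 X • w + b.coord 2 X • v 0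
        + b.coord 3 X • v 1 + b.coord 4 X • v 2 + d, b.coord 0 Y • x + b.coord 1 Y • w
        + b.coord 2 Y • v 0 + b.coord 3 Y • v 1 + b.coord 4 Y • v 2 + d'⁆ := by rw [← hX, ← hY]
    rw [hlie]
    simp only [lie_add, add_lie, lie_smul, smul_lie, hd1, hd2, lie_self, hw, hwx, hvx, hwv, h10,
      h21, h02, map_add, map_smul, map_neg, hQ, smul_eq_mul, map_zero, wedge, Matrix.cons_val, hζz]
    fin_cases i <;> simp <;> ring

/-- The fourth central coordinate `ζ 3` has no term in `e`, and its row `P 3` is nonzero because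
`d₀` is a combination of brackets. Pairing `ζ 3` with `e + ∑ mⱼ aⱼ` leaves enough freedom to close
the form. -/
theorem isSymplectic_of_four [FiniteDimensional K L] (hdim : finrank K L = 8)
    (hnil : ∀ X Y Z : L, ⁅X, ⁅Y, Z⁆⁆ = 0) {x d₀ : L} {v : Fin 3 → L}
    (hz : LinearIndependent K fun i => ⁅x, v i⁆)
    (hd₀ : d₀ ∈ Submodule.span K {d : L | ∃ X Y : L, ⁅X, Y⁆ = d})
    (hd₀' : d₀ ∉ Submodule.span K (Set.range fun i => ⁅x, v i⁆)) : IsSymplectic K L := by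
  have hcent : ∀ X : L, ∀ d ∈ Submodule.span K {d : L | ∃ X Y : L, ⁅X, Y⁆ = d}, ⁅X, d⁆ = 0 :=
    fun X d hd => lie_eq_zero_of_mem_span (by rintro X _ ⟨Y, Z, rfl⟩; exact hnil _ _ _) X hd
  set S := Submodule.span K (Set.range fun i => ⁅x, v i⁆) with hS
  have hzS : ∀ i, ⁅x, v i⁆ ∈ S := fun i => Submodule.subset_span ⟨i, rfl⟩
  have hcd₀ : ∀ X : L, ⁅X, d₀⁆ = 0 := fun X => hcent X d₀ hd₀
  have hcd₀' : ∀ X : L, ⁅d₀, X⁆ = 0 := fun X => by rw [← lie_skew, hcd₀, neg_zero]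
  have hnil' : ∀ X Y Z : L, ⁅⁅Y, Z⁆, X⁆ = 0 := fun X Y Z => by rw [← lie_skew, hnil, neg_zero]
  let B : Fin 8 → L := ![x, v 0, v 1, v 2, ⁅x, v 0⁆, ⁅x, v 1⁆, ⁅x, v 2⁆, d₀]
  have hcoef : ∀ g : Fin 8 → K, (∀ X : L, ⁅X, ∑ i, g i • B i⁆ = 0) →
      g 0 = 0 ∧ g 1 = 0 ∧ g 2 = 0 ∧ g 3 = 0 := by
    intro g hg
    simp only [B, Fin.sum_univ_eight, Matrix.cons_val] at hg
    have h1 := hg x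
    simp only [lie_add, lie_smul, lie_self, hcd₀, hnil, smul_zero, zero_add, add_zero] at h1
    obtain ⟨h2, h3, h4⟩ := coeff_eq_zero_of_linearIndependent hz h1
    have h5 := hg (v 0)
    simp only [lie_add, lie_smul, hcd₀, hnil, smul_zero, add_zero, h2, h3, h4,
      zero_smul] at h5
    refine ⟨(smul_eq_zero.1 h5).resolve_right fun h => hz.ne_zero 0 ?_, h2, h3, h4⟩
    change ⁅x, v 0⁆ = 0
    rw [← lie_skew, h, neg_zero]
  have hB : LinearIndependent K B := by
    rw [Fintype.linearIndependent_iff]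
    intro g hg
    obtain ⟨h0, h1, h2, h3⟩ := hcoef g fun X => by rw [hg, lie_zero]
    simp only [B, Fin.sum_univ_eight, Matrix.cons_val, h0, h1, h2, h3, zero_smul, zero_add] at hg
    have hd : g 4 • ⁅x, v 0⁆ + g 5 • ⁅x, v 1⁆ + g 6 • ⁅x, v 2⁆ ∈ S :=
      S.add_mem (S.add_mem (S.smul_mem _ (hzS 0)) (S.smul_mem _ (hzS 1))) (S.smul_mem _ (hzS 2))
    have h7 : g 7 = 0 := by
      by_contra hne
      refine hd₀' ((S.smul_mem_iff hne).1 ?_)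
      rw [eq_neg_of_add_eq_zero_right hg]
      exact S.neg_mem hd
    rw [h7, zero_smul, add_zero] at hg
    obtain ⟨h4, h5, h6⟩ := coeff_eq_zero_of_linearIndependent hz hg
    intro i
    fin_cases i
    exacts [h0, h1, h2, h3, h4, h5, h6, h7]
  let b := basisOfLinearIndependentOfCardEqFinrank hB (by rw [hdim, Fintype.card_fin])
  have hb : ∀ i, b i = B i := fun i => by simp [b]
  have hbB : ∀ i j, b.coord i (B j) = if j = i then 1 else 0 := fun i j => by
    rw [← hb, b.coord_apply, b.repr_self, Finsupp.single_apply]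
  have hsum : ∀ X, ∑ i, b.coord i X • B i = X := fun X => by
    conv_rhs => rw [← b.sum_repr X]
    simp only [hb, b.coord_apply]
  have hcl : ∀ X Y : L, b.coord 0 ⁅X, Y⁆ = 0 ∧ b.coord 1 ⁅X, Y⁆ = 0 ∧ b.coord 2 ⁅X, Y⁆ = 0 ∧
      b.coord 3 ⁅X, Y⁆ = 0 := fun X Y =>
    hcoef (fun i => b.coord i ⁅X, Y⁆) fun Z => by rw [hsum, hnil]
  let e := b.coord 0
  let a : Fin 3 → Dual K L := ![b.coord 1, b.coord 2, b.coord 3]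
  let ζ : Fin 4 → Dual K L := ![b.coord 4, b.coord 5, b.coord 6, b.coord 7]
  have he : ∀ X Y : L, e ⁅X, Y⁆ = 0 := fun X Y => (hcl X Y).1
  have ha : ∀ i, ∀ X Y : L, a i ⁅X, Y⁆ = 0 := fun i X Y => by
    fin_cases i
    exacts [(hcl X Y).2.1, (hcl X Y).2.2.1, (hcl X Y).2.2.2]
  obtain ⟨P, hP⟩ : ∃ P : Fin 4 → Fin 3 → K, ∀ i (X Y : L), ζ i ⁅X, Y⁆ =
      wedge e (![a 0, a 1, a 2, 0] i) X Y + (P i 0 * wedge (a 1) (a 2) X Y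
        + P i 1 * wedge (a 2) (a 0) X Y + P i 2 * wedge (a 0) (a 1) X Y) := by
    refine ⟨fun i => ![ζ i ⁅v 1, v 2⁆, ζ i ⁅v 2, v 0⁆, ζ i ⁅v 0, v 1⁆], fun i X Y => ?_⟩
    have hζz : ∀ j : Fin 3, ζ i ⁅x, v j⁆ = if j.castSucc = i then 1 else 0 := by
      intro j
      fin_cases i <;> fin_cases j
      exacts [hbB 4 4, hbB 4 5, hbB 4 6, hbB 5 4, hbB 5 5, hbB 5 6, hbB 6 4, hbB 6 5, hbB 6 6,
        hbB 7 4, hbB 7 5, hbB 7 6]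
    have hvx : ∀ j, ⁅v j, x⁆ = -⁅x, v j⁆ := fun j => (lie_skew _ _).symm
    have h10 : ⁅v 1, v 0⁆ = -⁅v 0, v 1⁆ := (lie_skew _ _).symm
    have h21 : ⁅v 2, v 1⁆ = -⁅v 1, v 2⁆ := (lie_skew _ _).symm
    have h02 : ⁅v 0, v 2⁆ = -⁅v 2, v 0⁆ := (lie_skew _ _).symm
    have hlie : ζ i ⁅X, Y⁆ = ζ i ⁅∑ i, b.coord i X • B i, ∑ i, b.coord i Y • B i⁆ := by
      rw [hsum, hsum]
    rw [hlie]
    simp only [Fin.sum_univ_eight, B, Matrix.cons_val, lie_add, add_lie, lie_smul, smul_lie,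
      hcd₀, hcd₀', hnil, hnil', lie_self, hvx, h10, h21, h02, map_add, map_smul, map_neg,
      smul_eq_mul, map_zero, wedge, hζz, e, a]
    fin_cases i <;> simp <;> ring
  obtain ⟨k, hk⟩ : ∃ k, P 3 k ≠ 0 := by
    by_contra! h0
    have hker : Submodule.span K {d : L | ∃ X Y : L, ⁅X, Y⁆ = d} ≤ LinearMap.ker (ζ 3) := by
      rw [Submodule.span_le]
      rintro _ ⟨X, Y, rfl⟩
      rw [SetLike.mem_coe, LinearMap.mem_ker, hP]
      simp [h0, wedge]
    have h1 : ζ 3 d₀ = 0 := hker hd₀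
    have h2 : ζ 3 d₀ = 1 := hbB 7 7
    exact zero_ne_one (h1.symm.trans h2)
  let T : K := P 0 0 + P 1 1 + P 2 2 + P 1 0 * P 3 2 - P 2 0 * P 3 1 + P 2 1 * P 3 0
  obtain ⟨m, hm⟩ : ∃ m : Fin 3 → K, T + (P 3 0 * m 0 + P 3 1 * m 1 + P 3 2 * m 2) = 0 := by
    have h := Fin.sum_univ_three fun j => P 3 j * (Pi.single k (-T / P 3 k) : Fin 3 → K) j
    rw [Finset.sum_eq_single_of_mem k (Finset.mem_univ k) fun j _ hj => by
      rw [Pi.single_eq_of_ne hj, mul_zero], Pi.single_eq_same, mul_div_cancel₀ _ hk] at h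
    exact ⟨Pi.single k (-T / P 3 k), by rw [← h, add_neg_cancel]⟩
  -- The corrections by entries of `P 3` cancel the terms in `e ∧ aᵢ ∧ aⱼ` coming from `ζ 3` against
  -- `e`. Only the coefficient of `a₀ ∧ a₁ ∧ a₂` remains, and `m` was chosen to kill it.
  refine isSymplectic_of_wedgeSum ζ ![a 0, P 3 2 • a 0 + a 1, a 2 + P 3 0 • a 1 - P 3 1 • a 0,
    e + (m 0 • a 0 + m 1 • a 1 + m 2 • a 2)] (by rw [hdim]) ?_ ?_ ?_
  · intro i X Y
    fin_cases i <;> simp [he, ha]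
  · intro X Y Z
    let D (α β γ : Dual K L) : K := α X * (β Y * γ Z - β Z * γ Y)
      - α Y * (β X * γ Z - β Z * γ X) + α Z * (β X * γ Y - β Y * γ X)
    simp only [Fin.sum_univ_four, hP, wedge, Matrix.cons_val, LinearMap.add_apply,
      LinearMap.sub_apply, LinearMap.smul_apply, smul_eq_mul, LinearMap.zero_apply]
    linear_combination hm * D (a 0) (a 1) (a 2)
  · intro X hζ hη
    have h0 : a 0 X = 0 := hη 0
    have h1 : a 1 X = 0 := by simpa [h0] using hη 1
    have h2 : a 2 X = 0 := by simpa [h0, h1] using hη 2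
    have h3 : e X = 0 := by simpa [h0, h1, h2] using hη 3
    refine b.forall_coord_eq_zero_iff.1 fun i => ?_
    fin_cases i
    exacts [h3, h0, h1, h2, hζ 0, hζ 1, hζ 2, hζ 3]

end LieAlgebra

/-! ### Endomorphisms of a three-dimensional space up to scalars. -/

namespace LieAlgebra

open Module

theorem linearIndependent_triple_iff {K V : Type*} [Field K] [AddCommGroup V] [Module K V]
    {u v w : V} : LinearIndependent K ![u, v, w] ↔
      ∀ a b c : K, a • u + b • v + c • w = 0 → a = 0 ∧ b = 0 ∧ c = 0 := by
  rw [Fintype.linearIndependent_iff]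
  refine ⟨fun h a b c habc => ?_, fun h g hg => ?_⟩
  · have := h ![a, b, c] (by simpa [Fin.sum_univ_three] using habc)
    exact ⟨this 0, this 1, this 2⟩
  · obtain ⟨h0, h1, h2⟩ := h (g 0) (g 1) (g 2) (by simpa [Fin.sum_univ_three] using hg)
    intro i
    fin_cases i
    exacts [h0, h1, h2]

variable {K E : Type*} [Field K] [AddCommGroup E] [Module K E]

theorem exists_eq_of_linearIndependent_triple (hE : finrank K E = 3) {u v w : E}
    (h : LinearIndependent K ![u, v, w]) (y : E) :
    ∃ a b c : K, y = a • u + b • v + c • w := by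
  have : FiniteDimensional K E := FiniteDimensional.of_finrank_pos (by rw [hE]; norm_num)
  let B := basisOfLinearIndependentOfCardEqFinrank h (by rw [hE, Fintype.card_fin])
  refine ⟨B.repr y 0, B.repr y 1, B.repr y 2, ?_⟩
  conv_lhs => rw [← B.sum_repr y]
  simp [Fin.sum_univ_three, B]

/-- An endomorphism of a three-dimensional space without cyclic vector is the sum of a scalar and
an endomorphism of rank at most one. -/
theorem exists_scalar_add_rank_one [CharZero K] (hE : finrank K E = 3) (Q : E →ₗ[K] E)
    (hQ : ∀ z, ¬ LinearIndependent K ![z, Q z, Q (Q z)]) :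
    ∃ (r : K) (u : E), ∀ y, ∃ c : K, Q y = r • y + c • u := by
  have : FiniteDimensional K E := FiniteDimensional.of_finrank_pos (by rw [hE]; norm_num)
  by_cases hscal : ∀ z, ¬ LinearIndependent K ![z, Q z]
  · obtain ⟨r, hr⟩ := LinearMap.exists_eq_smul_id_of_forall_notLinearIndependent hscal
    exact ⟨r, 0, fun y => ⟨0, by rw [hr]; simp⟩⟩
  push Not at hscal
  obtain ⟨z, hz⟩ := hscal
  obtain ⟨y, hy⟩ : ∃ y, y ∉ Submodule.span K (Set.range ![z, Q z]) := by
    by_contra! hall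
    have h1 := finrank_span_eq_card hz
    rw [(Submodule.eq_top_iff'.2 hall), finrank_top, hE] at h1
    simp at h1
  have hlin : ∀ t, t ∉ Submodule.span K (Set.range ![z, Q z]) →
      LinearIndependent K ![z, Q z, t] := fun t ht => by
    have h1 := linearIndependent_finCons.2 ⟨hz, ht⟩
    change LinearIndependent K ![t, z, Q z] at h1
    rw [linearIndependent_triple_iff] at h1 ⊢
    intro a b c habc
    obtain ⟨h2, h3, h4⟩ := h1 c a b (by rw [← habc]; module)
    exact ⟨h3, h4, h2⟩
  have hQQ : Q (Q z) ∈ Submodule.span K (Set.range ![z, Q z]) := by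
    by_contra hn
    exact hQ z (hlin _ hn)
  obtain ⟨α, β, hαβ⟩ : ∃ α β : K, α • z + β • Q z = Q (Q z) := by
    rwa [Matrix.range_cons_cons_empty, Submodule.mem_span_pair] at hQQ
  have hb := hlin y hy
  obtain ⟨γ, δ, r, hQy⟩ := exists_eq_of_linearIndependent_triple hE hb (Q y)
  -- Without cyclic vectors the plane `W` spanned by `z, Q z` is invariant. Put `u = (Q - r)(y + c
  -- z)`, which lies in `W`. If `u` and `Q u` were independent, `y + c z` would be cyclic, so their
  -- determinant vanishes for every `c`.
  have hdet : ∀ c : K, (γ - r * c) * ((γ - r * c) + β * (δ + c)) - α * ((δ + c) * (δ + c)) = 0 := by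
    intro c
    by_contra hne
    apply hQ (y + c • z)
    rw [linearIndependent_triple_iff] at hb ⊢
    have h1 : Q (y + c • z) = r • (y + c • z) + ((γ - r * c) • z + (δ + c) • Q z) := by
      rw [map_add, map_smul, hQy]
      module
    have h2 : Q (Q (y + c • z)) = (r * r) • (y + c • z)
        + ((r * (γ - r * c) + (δ + c) * α) • z
          + (r * (δ + c) + (γ - r * c) + (δ + c) * β) • Q z) := by
      rw [h1, map_add, map_smul, h1, map_add, map_smul, map_smul, ← hαβ]
      module
    intro a b d habd
    rw [h2, h1] at habd
    obtain ⟨h3, h4, h5⟩ := hb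
      ((a + b * r + d * (r * r)) * c + b * (γ - r * c) + d * (r * (γ - r * c) + (δ + c) * α))
      (b * (δ + c) + d * (r * (δ + c) + (γ - r * c) + (δ + c) * β))
      (a + b * r + d * (r * r)) (by rw [← habd]; module)
    rw [h5] at h3
    have hd : d = 0 := by
      refine (mul_eq_zero.1 (?_ : ((γ - r * c) * ((γ - r * c) + β * (δ + c))
        - α * ((δ + c) * (δ + c))) * d = 0)).resolve_left hne
      linear_combination (γ - r * c) * h4 - (δ + c) * h3
    have hb : b = 0 := by
      refine (mul_eq_zero.1 (?_ : ((γ - r * c) * ((γ - r * c) + β * (δ + c))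
        - α * ((δ + c) * (δ + c))) * b = 0)).resolve_left hne
      rw [hd] at h3 h4
      linear_combination ((γ - r * c) + β * (δ + c)) * h3 - α * (δ + c) * h4
    refine ⟨?_, hb, hd⟩
    rw [hb, hd] at h5
    linear_combination h5
  -- The coefficient of `c²` shows that `r` is a root of the characteristic polynomial of `Q` on
  -- `W`, so `r` is an eigenvalue in `K` without any algebraic closure.
  have hα : α = r * (r - β) := by
    have h2 : (2 : K) * (r * (r - β) - α) = 0 := by
      linear_combination hdet 1 + hdet (-1) - 2 * hdet 0
    linear_combination -((mul_eq_zero.1 h2).resolve_left two_ne_zero)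
  -- The determinant now factors as `(γ + r δ)(γ + (β - r) δ + (β - 2 r) c)`; if the second factor
  -- vanishes for all `c`, then `β = 2 r` and it equals the first.
  have hγ : γ + r * δ = 0 := by
    have h1 : (γ + r * δ) * (γ + (β - r) * δ) = 0 := by
      linear_combination hdet 0 + δ * δ * hα
    have h2 : (2 : K) * ((β - 2 * r) * (γ + r * δ)) = 0 := by
      linear_combination hdet 1 - hdet (-1) + 4 * δ * hα
    rcases mul_eq_zero.1 h1 with h3 | h3
    · exact h3
    · rcases mul_eq_zero.1 ((mul_eq_zero.1 h2).resolve_left two_ne_zero) with h4 | h4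
      · linear_combination h3 - δ * h4
      · exact h4
  refine ⟨r, -r • z + Q z, fun t => ?_⟩
  obtain ⟨a, b, c, rfl⟩ := exists_eq_of_linearIndependent_triple hE hb t
  refine ⟨a + b * (β - r) + c * δ, ?_⟩
  have hγ' : γ = -r * δ := by linear_combination hγ
  rw [map_add, map_add, map_smul, map_smul, map_smul, hQy, ← hαβ, hα, hγ']
  module

/-- Normal forms, up to the addition of a scalar, of an endomorphism of a three-dimensional
space. -/
theorem exists_normalForm [CharZero K] (hE : finrank K E = 3) (Q : E →ₗ[K] E) :
    ∃ (z : Fin 3 → E) (r : K), LinearIndependent K z ∧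
      ((r = 0 ∧ Q (z 0) = z 1 ∧ Q (z 1) = z 2) ∨
      (∀ i, Q (z i) = r • z i) ∨
      (∃ l : K, l ≠ 0 ∧ Q (z 0) = r • z 0 + l • z 0 ∧ Q (z 1) = r • z 1 ∧ Q (z 2) = r • z 2) ∨
      (Q (z 0) = r • z 0 ∧ Q (z 1) = r • z 1 + z 0 ∧ Q (z 2) = r • z 2)) := by
  have : FiniteDimensional K E := FiniteDimensional.of_finrank_pos (by rw [hE]; norm_num)
  by_cases hcyc : ∃ z, LinearIndependent K ![z, Q z, Q (Q z)]
  · obtain ⟨z, hz⟩ := hcyc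
    exact ⟨_, 0, hz, Or.inl ⟨rfl, rfl, rfl⟩⟩
  push Not at hcyc
  obtain ⟨r, u₀, hu₀⟩ := exists_scalar_add_rank_one hE Q hcyc
  by_cases hzero : ∀ y, Q y = r • y
  · let B := Module.finBasisOfFinrankEq K E hE
    exact ⟨B, r, B.linearIndependent, Or.inr (Or.inl fun i => hzero _)⟩
  push Not at hzero
  obtain ⟨x, hx⟩ := hzero
  let N : E →ₗ[K] E := Q - r • LinearMap.id
  have hN : ∀ y, Q y = r • y + N y := fun y => by simp [N]
  have hNx : N x ≠ 0 := fun h => hx (by rw [hN, h, add_zero])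
  have hrange : LinearMap.range N ≤ Submodule.span K {u₀} := by
    rintro _ ⟨y, rfl⟩
    obtain ⟨c, hc⟩ := hu₀ y
    rw [Submodule.mem_span_singleton]
    refine ⟨c, ?_⟩
    rw [hN] at hc
    exact (add_left_cancel hc).symm
  have hker : 1 < finrank K (LinearMap.ker N) := by
    have h1 := LinearMap.finrank_range_add_finrank_ker N
    have h2 : finrank K (LinearMap.range N) ≤ 1 := (Submodule.finrank_mono hrange).trans
      ((finrank_span_le_card {u₀}).trans_eq (by simp))
    omega
  have hNN : ∃ l : K, N (N x) = l • N x := by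
    obtain ⟨c, hc⟩ := Submodule.mem_span_singleton.1 (hrange ⟨x, rfl⟩)
    obtain ⟨d, hd⟩ := Submodule.mem_span_singleton.1 (hrange ⟨N x, rfl⟩)
    have hc0 : c ≠ 0 := by
      rintro rfl
      exact hNx (by rw [← hc, zero_smul])
    exact ⟨d * c⁻¹, by rw [← hd, ← hc, smul_smul, mul_assoc, inv_mul_cancel₀ hc0, mul_one]⟩
  have hpair : ∀ k : LinearMap.ker N, k ≠ 0 → ∃ k' : E, N k' = 0 ∧
      ∀ a b : K, a • (k : E) + b • k' = 0 → a = 0 ∧ b = 0 := by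
    intro k hk
    obtain ⟨k', hk'⟩ := exists_linearIndependent_pair_of_one_lt_finrank hker hk
    rw [LinearIndependent.pair_iff] at hk'
    exact ⟨k', k'.2, fun a b hab => hk' a b (Subtype.ext (by simpa using hab))⟩
  obtain ⟨l, hl⟩ := hNN
  -- `N` has rank one with image spanned by `N x`. It is nilpotent if `l = 0`; otherwise `N x` is an
  -- eigenvector complementary to the kernel.
  by_cases hl0 : l = 0
  · rw [hl0, zero_smul] at hl
    obtain ⟨k, hk, hind⟩ := hpair ⟨N x, hl⟩ fun h => hNx (congrArg Subtype.val h)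
    refine ⟨![N x, x, k], r, linearIndependent_triple_iff.2 fun a b c habc => ?_,
      Or.inr (Or.inr (Or.inr ⟨?_, hN x, ?_⟩))⟩
    · have h1 := congrArg N habc
      rw [map_add, map_add, map_smul, map_smul, map_smul, hl, hk, smul_zero, smul_zero, zero_add,
        add_zero, map_zero] at h1
      have hb := (smul_eq_zero.1 h1).resolve_right hNx
      rw [hb, zero_smul, add_zero] at habc
      exact ⟨(hind a c habc).1, hb, (hind a c habc).2⟩
    · change Q (N x) = r • N x
      rw [hN, hl, add_zero]
    · change Q k = r • k
      rw [hN, hk, add_zero]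
  · have : Nontrivial (LinearMap.ker N) := Module.nontrivial_of_finrank_pos (R := K) (zero_lt_one.trans hker)
    obtain ⟨k, hk0⟩ := exists_ne (0 : LinearMap.ker N)
    obtain ⟨k', hk', hind⟩ := hpair k hk0
    have hk : N k = 0 := k.2
    refine ⟨![N x, k, k'], r, linearIndependent_triple_iff.2 fun a b c habc => ?_,
      Or.inr (Or.inr (Or.inl ⟨l, hl0, ?_, ?_, ?_⟩))⟩
    · have h1 := congrArg N habc
      rw [map_add, map_add, map_smul, map_smul, map_smul, hl, hk, hk', smul_zero, smul_zero,
        add_zero, add_zero, map_zero, smul_smul] at h1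
      have ha := (mul_eq_zero.1 ((smul_eq_zero.1 h1).resolve_right hNx)).resolve_right hl0
      rw [ha, zero_smul, zero_add] at habc
      exact ⟨ha, hind b c habc⟩
    · change Q (N x) = r • N x + l • N x
      rw [hN, hl]
    · change Q k = r • (k : E)
      rw [hN, hk, add_zero]
    · change Q k' = r • k'
      rw [hN, hk', add_zero]

end LieAlgebra

/-! ### From the characteristic sequence to the dichotomy. -/

theorem LinearMap.HasNilpotentJordanType.exists_linearIndependent {K V : Type*} [Field K]
    [AddCommGroup V] [Module K V] {T : V →ₗ[K] V}
    (h : T.HasNilpotentJordanType [2, 2, 2, 1, 1]) :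
    ∃ v : Fin 3 → V, LinearIndependent K fun i => T (v i) := by
  obtain ⟨-, -, b, hb⟩ := h
  have h3 : 3 ≤ [2, 2, 2, 1, 1].length := by decide
  have hl : ∀ i : Fin 3, 1 < [2, 2, 2, 1, 1].get (Fin.castLE h3 i) := by decide +revert
  -- The first three blocks have size 2, and each sends its top vector to its bottom one.
  have hv : ∀ i : Fin 3, T (b ⟨Fin.castLE h3 i, ⟨0, zero_lt_one.trans (hl i)⟩⟩)
      = b ⟨Fin.castLE h3 i, ⟨1, hl i⟩⟩ := fun i => by
    rw [hb, dif_pos (hl i)]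
  refine ⟨fun i => b ⟨Fin.castLE h3 i, ⟨0, zero_lt_one.trans (hl i)⟩⟩, ?_⟩
  simp only [hv]
  refine b.linearIndependent.comp
    (fun i : Fin 3 => ⟨Fin.castLE h3 i, ⟨1, hl i⟩⟩) fun i j hij => ?_
  exact Fin.castLE_injective h3 (congrArg Sigma.fst hij)

namespace LieAlgebra

open Module

variable {K L : Type*} [Field K] [LieRing L] [LieAlgebra K L]

theorem IsStepNilpotent.lie_lie_eq_zero (h : IsStepNilpotent K L 2) (X Y Z : L) :
    ⁅X, ⁅Y, Z⁆⁆ = 0 := by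
  have h1 : ⁅X, ⁅Y, Z⁆⁆ ∈ LieModule.lowerCentralSeries K L L 2 := by
    rw [LieModule.lowerCentralSeries_succ, LieModule.lowerCentralSeries_succ]
    exact LieSubmodule.lie_mem_lie (LieSubmodule.mem_top _)
      (LieSubmodule.lie_mem_lie (LieSubmodule.mem_top _) (LieSubmodule.mem_top _))
  rw [h.1] at h1
  exact (LieSubmodule.mem_bot _).1 h1

/-- A dimension count: `ad x` has rank at most 3, so its kernel has dimension at least 5, while `K x
+ S` has dimension at most 4. -/
theorem exists_mem_ker_ad_notMem [FiniteDimensional K L] (hdim : finrank K L = 8) (x : L)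
    {S : Submodule K L} (hS : finrank K S = 3) (hD : ∀ X Y : L, ⁅X, Y⁆ ∈ S) :
    ∃ w, ⁅x, w⁆ = 0 ∧ ∀ s : K, w - s • x ∉ S := by
  have h1 := LinearMap.finrank_range_add_finrank_ker (ad K L x : L →ₗ[K] L)
  have h2 : LinearMap.range (ad K L x : L →ₗ[K] L) ≤ S := by
    rintro _ ⟨y, rfl⟩
    exact hD x y
  have h3 := Submodule.finrank_mono h2
  have h4 := Submodule.finrank_add_le_finrank_add_finrank (Submodule.span K {x}) S
  have h5 : finrank K (Submodule.span K {x}) ≤ 1 :=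
    (finrank_span_le_card {x}).trans_eq (by simp)
  obtain ⟨w, hw, hwn⟩ : ∃ w ∈ LinearMap.ker (ad K L x : L →ₗ[K] L),
      w ∉ Submodule.span K {x} ⊔ S := by
    rw [← SetLike.not_le_iff_exists]
    intro hle
    have h6 := Submodule.finrank_mono hle
    omega
  refine ⟨w, hw, fun s hs => hwn ?_⟩
  rw [← add_sub_cancel (s • x) w]
  exact Submodule.add_mem_sup (Submodule.smul_mem _ _ (Submodule.mem_span_singleton_self x)) hs

theorem isSymplectic_or_nonempty_equiv [CharZero K] [FiniteDimensional K L]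
    (hdim : finrank K L = 8) (hnil : ∀ X Y Z : L, ⁅X, ⁅Y, Z⁆⁆ = 0) {x : L} {v : Fin 3 → L}
    (hz : LinearIndependent K fun i => ⁅x, v i⁆) :
    IsSymplectic K L ∨ Nonempty (L ≃ₗ⁅K⁆ ExceptionalAlgebra K) := by
  set S := Submodule.span K (Set.range fun i => ⁅x, v i⁆) with hS
  by_cases hD : ∀ X Y : L, ⁅X, Y⁆ ∈ S
  swap
  · push Not at hD
    obtain ⟨X, Y, hXY⟩ := hD
    exact Or.inl (isSymplectic_of_four hdim hnil hz (Submodule.subset_span ⟨X, Y, rfl⟩) hXY)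
  have hS3 : finrank K S = 3 := by rw [hS, finrank_span_eq_card hz, Fintype.card_fin]
  obtain ⟨w, hw, hwS⟩ := exists_mem_ker_ad_notMem hdim x hS3 hD
  -- A linear section of `ad x` over `S`, through which `w` acts as the endomorphism `d ↦ ⁅s d, w⁆`
  -- of `S`.
  let s : S →ₗ[K] L := (Basis.span hz).constr K v
  have hs : ∀ d : S, ⁅x, s d⁆ = d := by
    have : (ad K L x : L →ₗ[K] L) ∘ₗ s = S.subtype := by
      refine (Basis.span hz).ext fun i => ?_
      have h1 : s (Basis.span hz i) = v i := (Basis.span hz).constr_basis K v i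
      rw [LinearMap.comp_apply, h1, Submodule.subtype_apply, Basis.span_apply]
      rfl
    exact fun d => LinearMap.congr_fun this d
  let Q : S →ₗ[K] S := (-(ad K L w : L →ₗ[K] L) ∘ₗ s).codRestrict S fun d => S.neg_mem (hD _ _)
  have hQ : ∀ d : S, (Q d : L) = ⁅s d, w⁆ := fun d => lie_skew _ _
  obtain ⟨z, r, hzi, hcases⟩ := exists_normalForm hS3 Q
  have hzL : LinearIndependent K fun i => (z i : L) :=
    hzi.map' S.subtype (Submodule.ker_subtype S)
  have hspan : Submodule.span K (Set.range fun i => ⁅x, s (z i)⁆) = S := by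
    simp only [hs]
    refine Submodule.eq_of_le_of_finrank_eq ?_ ?_
    · rw [Submodule.span_le]
      rintro _ ⟨i, rfl⟩
      exact (z i).2
    · rw [finrank_span_eq_card hzL, hS3, Fintype.card_fin]
  have hframe : ∀ q : Fin 3 → Fin 3 → K,
      (∀ j, Q (z j) = r • z j + (q 0 j • z 0 + q 1 j • z 1 + q 2 j • z 2)) →
      ∃ (e f : Dual K L) (a ζ : Fin 3 → Dual K L) (P : Fin 3 → Fin 3 → K),
        Coframe₃ K e f a ζ P q := by
    intro q hq
    -- Since `⁅s d, x⁆ = -d`, adding `r • x` to `w` removes the scalar part `r` of `Q`.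
    refine exists_coframe₃ (x := x) (w := w + r • x) (v := fun i => s (z i)) hdim hnil
      (by simpa only [hs] using hzL) (fun X Y => by rw [hspan]; exact hD X Y)
      (by rw [lie_add, lie_smul, hw, lie_self, smul_zero, add_zero]) (fun t ht => ?_) q
      fun j => ?_
    · rw [hspan] at ht
      apply hwS (t - r)
      rwa [show w - (t - r) • x = w + r • x - t • x by module]
    · have h1 := congrArg Subtype.val (hq j)
      rw [hQ] at h1
      rw [lie_add, lie_smul, h1, ← lie_skew, hs, hs, hs, hs]
      push_cast
      module
  rcases hcases with ⟨rfl, h0, h1⟩ | h | ⟨l, hl, h0, h1, h2⟩ | ⟨h0, h1, h2⟩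
  · obtain ⟨a, b, c, habc⟩ := exists_eq_of_linearIndependent_triple hS3
      (u := z 0) (v := z 1) (w := z 2) (by convert hzi using 1; ext i; fin_cases i <;> rfl)
      (Q (z 2))
    obtain ⟨_, _, _, _, _, hF⟩ := hframe ![![0, 0, a], ![1, 0, b], ![0, 1, c]] fun j => by
      fin_cases j
      · simpa using h0
      · simpa using h1
      · simpa using habc
    exact Or.inl (hF.isSymplectic_of_cyclic hdim rfl rfl rfl rfl rfl rfl)
  · obtain ⟨_, _, _, _, _, hF⟩ := hframe (fun _ _ => 0) fun j => by simpa using h j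
    exact Or.inl (hF.isSymplectic_of_zero hdim fun _ _ => rfl)
  · obtain ⟨_, _, _, _, P, hF⟩ := hframe (fun i j => if i = 0 ∧ j = 0 then l else 0) fun j => by
      fin_cases j
      · simpa using h0
      · simpa using h1
      · simpa using h2
    by_cases hP : P 0 0 = 0 ∨ P 1 1 ≠ 0 ∨ P 2 2 ≠ 0 ∨ P 1 2 + P 2 1 ≠ 0
    · exact Or.inl (hF.isSymplectic_of_diagonal hdim l (fun _ _ => rfl) hP)
    · push Not at hP
      exact Or.inr (hF.nonempty_equiv_exceptionalAlgebra hdim l hl (fun _ _ => rfl) hP.1 hP.2.1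
        hP.2.2.1 hP.2.2.2)
  · obtain ⟨_, _, _, _, _, hF⟩ := hframe (fun i j => if i = 0 ∧ j = 1 then 1 else 0) fun j => by
      fin_cases j
      · simpa using h0
      · simpa using h1
      · simpa using h2
    exact Or.inl (hF.isSymplectic_of_nilpotent hdim fun _ _ => rfl)

end LieAlgebra

theorem mainTheorem1 (K : Type*) [RCLike K] (L : Type*) [LieRing L] [LieAlgebra K L]
    (hdim : Module.finrank K L = 8)
    (hnil : LieAlgebra.IsStepNilpotent K L 2)
    (hchar : LieAlgebra.IsCharacteristicSequence K L [2, 2, 2, 1, 1]) :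
    LieAlgebra.IsSymplectic K L ↔ ¬ Nonempty (L ≃ₗ⁅K⁆ ExceptionalAlgebra K) := by
  have : FiniteDimensional K L := FiniteDimensional.of_finrank_pos (by rw [hdim]; norm_num)
  obtain ⟨⟨x, -, hx⟩, -⟩ := hchar
  obtain ⟨v, hv⟩ := hx.exists_linearIndependent
  refine ⟨fun h ⟨φ⟩ => ExceptionalAlgebra.not_isSymplectic K (h.of_equiv φ.symm), fun h => ?_⟩
  exact (LieAlgebra.isSymplectic_or_nonempty_equiv hdim hnil.lie_lie_eq_zero hv).resolve_right h
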